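/- Let $k$ be a field. In a $k$-linear additive category call an object $X$ simple if $\operatorname{End}(X)\cong k$. Let $\mathcal C$ be a multi-fusion category over $k$, that is, a $k$-linear additive autonomous monoidal category with $k$-bilinear tensor product of morphisms and finite-dimensional morphism spaces which is finitely split semisimple: every object is isomorphic to a finite biproduct of simple objects, $\operatorname{Hom}(X,Y)=0$ for non-isomorphic simple objects $X,Y$, and there are only finitely many simple objects up to isomorphism. Let $\{V_j\}_{j\in I}$ be a family containing exactly one representative of each isomorphism class of simple objects, let $\hat V=\bigoplus_{j\in I}V_j$, and let $$\omega\colon\mathcal C\to\mathbf{Vect}_k,\qquad X\mapsto\operatorname{Hom}(\hat V,\hat V\otimes X),\quad f\mapsto(\mathrm{id}_{\hat V}\otimes f)\circ-$$ be the long canonical functor. Let $H=\mathbf{coend}(\mathcal C,\omega)=\int^{X}(\omega X)^\ast\otimes\omega X$ be the (coalgebra underlying the) Weak Hopf Algebra reconstructed from $\mathcal C$. Writing $[\theta|v]_X\in H$ for the class of $\theta\otimes v$, $\theta\in(\omega X)^\ast$, $v\in\omega X$, its comultiplication and counit are $$\Delta([\theta|v]_X)=\sum_m[\theta|e_m]_X\otimes[e^m|v]_X,\qquad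 \epsilon([\theta|v]_X)=\theta(v),$$ where $(e_m)_m$ and $(e^m)_m$ are dual bases of $\omega X$ and $(\omega X)^\ast$. A linear form $\zeta\colon H\to k$ is called dual central if $\zeta(x')x''=x'\zeta(x'')$ for all $x\in H$, and convolution invertible if there is a linear form $\bar\zeta\colon H\to k$ with $\zeta(x')\bar\zeta(x'')=\epsilon(x)=\bar\zeta(x')\zeta(x'')$ for all $x\in H$. For every $j\in I$ there is a unique linear form $\zeta_j\colon H\to k$ such that, for all simple $X\in\mathcal C$, $\theta\in(\omega X)^\ast$ and $v\in\omega X$, $$\zeta_j([\theta|v]_X)=\begin{cases}\epsilon([\theta|v]_X)&\text{if }X\cong V_j,\\0&\text{otherwise.}\end{cases}$$ The family $\{\zeta_j\}_{j\in I}$ is a basis of the vector space of all dual central linear forms on $H$. Moreover, for $c_j\in k$, the linear form $\sum_{j\in I}c_j\zeta_j$ is convolution invertible if and only if $c_j\neq0$ for all $j\in I$. -/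

import Mathlib

open CategoryTheory CategoryTheory.Limits CategoryTheory.MonoidalCategory
open scoped TensorProduct DirectSum

universe w v u

noncomputable section

namespace TannakaKrein

/-! ### Multi-fusion categories -/

section Semisimple

variable (k : Type w) [Field k] {C : Type u} [Category.{v} C] [Preadditive C] [Linear k C]

/-- An object `X` of a `k`-linear category is (split) simple if `End X ≅ k`. -/
def IsSplitSimple (X : C) : Prop :=
  Nonempty (End X ≃ₐ[k] k)

variable (C) in
/-- A `k`-linear additive monoidal category is multi-fusion if it is autonomous, has
finite-dimensional morphism spaces and is finitely split semisimple: every object is a finite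
biproduct of simple objects, there are no non-zero morphisms between non-isomorphic simple objects,
and there are only finitely many simple objects up to isomorphism. Autonomy is expressed by the
instance argument `[RigidCategory C]`. -/
class IsMultiFusion [HasFiniteBiproducts C] [MonoidalCategory C] [MonoidalPreadditive C]
    [MonoidalLinear k C] [RigidCategory C] : Prop where
  finiteDimensional_hom : ∀ X Y : C, FiniteDimensional k (X ⟶ Y)
  exists_iso_biproduct : ∀ X : C, ∃ (n : ℕ) (S : Fin n → C),
    (∀ i, IsSplitSimple k (S i)) ∧ Nonempty (X ≅ ⨁ S)
  hom_eq_zero : ∀ {X Y : C}, IsSplitSimple k X → IsSplitSimple k Y → ¬ Nonempty (X ≅ Y) →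
    ∀ f : X ⟶ Y, f = 0
  finite_simples : ∃ (n : ℕ) (S : Fin n → C),
    ∀ X : C, IsSplitSimple k X → ∃ i, Nonempty (X ≅ S i)

/-- `V` is a family of representatives of the isomorphism classes of simple objects, with exactly
one representative for each class. -/
structure IsSimpleRepresentatives {I : Type*} (V : I → C) : Prop where
  simple : ∀ j, IsSplitSimple k (V j)
  injective : ∀ i j, Nonempty (V i ≅ V j) → i = j
  exhaustive : ∀ X : C, IsSplitSimple k X → ∃ j, Nonempty (X ≅ V j)

end Semisimple

/-! ### The universal coend of a functor to vector spaces, and its coalgebra structure -/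

section Coend

variable {k : Type w} [Field k] {C : Type u} [Category.{v} C] (F : C ⥤ ModuleCat.{v} k)

/-- The summand `F(X)^* ⊗ F(X)`. -/
abbrev CoendSummand (X : C) : Type (max v w) :=
  Module.Dual k (F.obj X) ⊗[k] F.obj X

instance (X : C) : AddCommGroup (CoendSummand F X) :=
  TensorProduct.addCommGroup

open Classical in
/-- The relations `θ ⊗ F(f)(v) ∼ F(f)^*(θ) ⊗ v` for `f : X ⟶ Y`, `θ ∈ F(Y)^*`, `v ∈ F(X)`. -/
def coendRelations : Submodule k (⨁ X : C, CoendSummand F X) :=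
  Submodule.span k
    {z | ∃ (X Y : C) (f : X ⟶ Y) (θ : Module.Dual k (F.obj Y)) (v : F.obj X),
      z = DirectSum.lof k C (CoendSummand F) Y (θ ⊗ₜ[k] (F.map f).hom v) -
        DirectSum.lof k C (CoendSummand F) X ((θ ∘ₗ (F.map f).hom) ⊗ₜ[k] v)}

/-- The universal coend `coend(C, F) = ∫^X F(X)^* ⊗ F(X)`. -/
def Coend : Type (max u v w) :=
  (⨁ X : C, CoendSummand F X) ⧸ coendRelations F

instance : AddCommGroup (Coend F) :=
  inferInstanceAs (AddCommGroup ((⨁ X : C, CoendSummand F X) ⧸ coendRelations F))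

instance : Module k (Coend F) :=
  inferInstanceAs (Module k ((⨁ X : C, CoendSummand F X) ⧸ coendRelations F))

namespace Coend

open Classical in
/-- The canonical map `F(X)^* ⊗ F(X) → coend(C, F)`. -/
def ι (X : C) : CoendSummand F X →ₗ[k] Coend F :=
  (coendRelations F).mkQ ∘ₗ DirectSum.lof k C (CoendSummand F) X

/-- The element `[θ|v]_X` of the coend. -/
def bracket (X : C) (θ : Module.Dual k (F.obj X)) (v : F.obj X) : Coend F :=
  ι F X (θ ⊗ₜ[k] v)

variable {F}

theorem bracket_sum_left {J : Type*} [Fintype J] (X : C) (a : J → k)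
    (θ : J → Module.Dual k (F.obj X)) (v : F.obj X) :
    bracket F X (∑ m, a m • θ m) v = ∑ m, a m • bracket F X (θ m) v := by
  simp [bracket, TensorProduct.sum_tmul, ← TensorProduct.smul_tmul']

theorem bracket_sum_right {J : Type*} [Fintype J] (X : C) (a : J → k)
    (θ : Module.Dual k (F.obj X)) (v : J → F.obj X) :
    bracket F X θ (∑ m, a m • v m) = ∑ m, a m • bracket F X θ (v m) := by
  simp [bracket, TensorProduct.tmul_sum]

theorem dual_eq_sum (X : C) [FiniteDimensional k (F.obj X)] (θ : Module.Dual k (F.obj X)) :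
    θ = ∑ m, θ (Module.finBasis k (F.obj X) m) • (Module.finBasis k (F.obj X)).coord m := by
  refine (Module.finBasis k (F.obj X)).ext fun i => ?_
  simp

theorem bracket_map {X Y : C} (f : X ⟶ Y) (θ : Module.Dual k (F.obj Y)) (v : F.obj X) :
    bracket F Y θ ((F.map f).hom v) = bracket F X (θ ∘ₗ (F.map f).hom) v := by
  refine (Submodule.Quotient.eq (coendRelations F)).2 (Submodule.subset_span ?_)
  exact ⟨X, Y, f, θ, v, rfl⟩

theorem hom_ext {M : Type*} [AddCommGroup M] [Module k M] {a b : Coend F →ₗ[k] M}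
    (h : ∀ X θ v, a (bracket F X θ v) = b (bracket F X θ v)) : a = b := by
  classical
  refine Submodule.linearMap_qext _ (DirectSum.linearMap_ext k fun X => ?_)
  exact TensorProduct.ext' fun θ v => h X θ v

open Classical in
/-- The linear map out of the coend induced by a dinatural family. -/
def desc {M : Type*} [AddCommGroup M] [Module k M] (a : ∀ X : C, CoendSummand F X →ₗ[k] M)
    (ha : ∀ {X Y : C} (f : X ⟶ Y) (θ : Module.Dual k (F.obj Y)) (v : F.obj X),
      a Y (θ ⊗ₜ[k] (F.map f).hom v) = a X ((θ ∘ₗ (F.map f).hom) ⊗ₜ[k] v)) :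
    Coend F →ₗ[k] M :=
  (coendRelations F).liftQ (DirectSum.toModule k C M a) <| by
    refine Submodule.span_le.2 ?_
    rintro _ ⟨X, Y, f, θ, v, rfl⟩
    simp [ha]

theorem desc_bracket {M : Type*} [AddCommGroup M] [Module k M]
    (a : ∀ X : C, CoendSummand F X →ₗ[k] M)
    (ha : ∀ {X Y : C} (f : X ⟶ Y) (θ : Module.Dual k (F.obj Y)) (v : F.obj X),
      a Y (θ ⊗ₜ[k] (F.map f).hom v) = a X ((θ ∘ₗ (F.map f).hom) ⊗ₜ[k] v))
    (X : C) (θ : Module.Dual k (F.obj X)) (v : F.obj X) :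
    desc a ha (bracket F X θ v) = a X (θ ⊗ₜ[k] v) := by
  classical
  exact DirectSum.toModule_lof (ι := C) (M := CoendSummand F) k X (θ ⊗ₜ[k] v)

theorem contractLeft_naturality {X Y : C} (f : X ⟶ Y) (θ : Module.Dual k (F.obj Y))
    (v : F.obj X) :
    contractLeft k (F.obj Y) (θ ⊗ₜ[k] (F.map f).hom v) =
      contractLeft k (F.obj X) ((θ ∘ₗ (F.map f).hom) ⊗ₜ[k] v) := by
  simp

/-- The counit, `ε([θ|v]_X) = θ(v)`. -/
def counit : Coend F →ₗ[k] k :=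
  desc (fun X => contractLeft k (F.obj X)) contractLeft_naturality

theorem counit_bracket (X : C) (θ : Module.Dual k (F.obj X)) (v : F.obj X) :
    counit (bracket F X θ v) = θ v := by
  exact desc_bracket _ contractLeft_naturality X θ v

variable [∀ X, FiniteDimensional k (F.obj X)]

/-- The comultiplication on the summand `F(X)^* ⊗ F(X)`,
`θ ⊗ v ↦ ∑ m, [θ|e_m]_X ⊗ [e^m|v]_X` for a pair of dual bases `e_m`, `e^m` of `F(X)`. -/
def comulAux (X : C) : CoendSummand F X →ₗ[k] Coend F ⊗[k] Coend F :=
  ∑ m, TensorProduct.map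
    (ι F X ∘ₗ (TensorProduct.mk k _ _).flip (Module.finBasis k (F.obj X) m))
    (ι F X ∘ₗ TensorProduct.mk k _ _ ((Module.finBasis k (F.obj X)).coord m))

theorem comulAux_tmul (X : C) (θ : Module.Dual k (F.obj X)) (v : F.obj X) :
    comulAux X (θ ⊗ₜ[k] v) =
      ∑ m, bracket F X θ (Module.finBasis k (F.obj X) m) ⊗ₜ[k]
        bracket F X ((Module.finBasis k (F.obj X)).coord m) v := by
  simp [comulAux, bracket]

theorem comulAux_naturality {X Y : C} (f : X ⟶ Y) (θ : Module.Dual k (F.obj Y)) (v : F.obj X) :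
    comulAux Y (θ ⊗ₜ[k] (F.map f).hom v) =
      comulAux X ((θ ∘ₗ (F.map f).hom) ⊗ₜ[k] v) := by
  rw [comulAux_tmul, comulAux_tmul]
  have h1 : ∀ m, bracket F Y ((Module.finBasis k (F.obj Y)).coord m) ((F.map f).hom v) =
      ∑ n, (Module.finBasis k (F.obj Y)).coord m ((F.map f).hom (Module.finBasis k (F.obj X) n)) •
        bracket F X ((Module.finBasis k (F.obj X)).coord n) v := by
    intro m
    rw [bracket_map, dual_eq_sum X (_ ∘ₗ _), bracket_sum_left]
    rfl
  have h2 : ∀ n, bracket F X (θ ∘ₗ (F.map f).hom) (Module.finBasis k (F.obj X) n) =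
      ∑ m, (Module.finBasis k (F.obj Y)).coord m ((F.map f).hom (Module.finBasis k (F.obj X) n)) •
        bracket F Y θ (Module.finBasis k (F.obj Y) m) := by
    intro n
    rw [← bracket_map]
    conv_lhs => rw [← (Module.finBasis k (F.obj Y)).sum_repr
      ((F.map f).hom (Module.finBasis k (F.obj X) n))]
    rw [bracket_sum_right]
    rfl
  simp only [h1, h2, TensorProduct.tmul_sum, TensorProduct.sum_tmul, TensorProduct.tmul_smul,
    TensorProduct.smul_tmul']
  exact Finset.sum_comm

/-- The comultiplication, `Δ([θ|v]_X) = ∑ m, [θ|e_m]_X ⊗ [e^m|v]_X`. -/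
def comul : Coend F →ₗ[k] Coend F ⊗[k] Coend F :=
  desc comulAux comulAux_naturality

theorem comul_bracket (X : C) (θ : Module.Dual k (F.obj X)) (v : F.obj X) :
    comul (bracket F X θ v) =
      ∑ m, bracket F X θ (Module.finBasis k (F.obj X) m) ⊗ₜ[k]
        bracket F X ((Module.finBasis k (F.obj X)).coord m) v := by
  rw [comul, desc_bracket, comulAux_tmul]

instance : Coalgebra k (Coend F) where
  comul := comul
  counit := counit
  coassoc := by
    refine hom_ext fun X θ v => ?_
    simp only [LinearMap.comp_apply, comul_bracket, map_sum, LinearMap.rTensor_tmul,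
      LinearMap.lTensor_tmul, TensorProduct.sum_tmul, TensorProduct.tmul_sum,
      LinearEquiv.coe_coe, TensorProduct.assoc_tmul]
    exact Finset.sum_comm
  rTensor_counit_comp_comul := by
    refine hom_ext fun X θ v => ?_
    simp only [LinearMap.comp_apply, comul_bracket, map_sum, LinearMap.rTensor_tmul,
      counit_bracket, TensorProduct.mk_apply]
    conv_rhs => rw [dual_eq_sum X θ, bracket_sum_left, TensorProduct.tmul_sum]
    refine Finset.sum_congr rfl fun m _ => ?_
    rw [← TensorProduct.smul_tmul, smul_eq_mul, mul_one]
  lTensor_counit_comp_comul := by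
    refine hom_ext fun X θ v => ?_
    simp only [LinearMap.comp_apply, comul_bracket, map_sum, LinearMap.lTensor_tmul,
      counit_bracket, LinearMap.flip_apply, TensorProduct.mk_apply]
    conv_rhs => rw [← (Module.finBasis k (F.obj X)).sum_repr v, bracket_sum_right,
      TensorProduct.sum_tmul]
    refine Finset.sum_congr rfl fun m _ => ?_
    rw [TensorProduct.smul_tmul, smul_eq_mul, mul_one]
    rfl

end Coend

end Coend

/-! ### The reconstructed coalgebra -/

section LongFunctor

variable (k : Type w) [Field k] {C : Type u} [Category.{v} C] [Preadditive C] [Linear k C]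
  [HasFiniteBiproducts C] [MonoidalCategory C] [MonoidalPreadditive C] [MonoidalLinear k C]

/-- The long canonical functor `X ↦ Hom(V̂, V̂ ⊗ X)`, `f ↦ (id ⊗ f) ∘ -`, where `V̂ = ⨁ j, V j`. -/
def longFunctor {I : Type*} [Fintype I] (V : I → C) : C ⥤ ModuleCat.{v} k :=
  tensorLeft (⨁ V) ⋙ (linearCoyoneda k C).obj (Opposite.op (⨁ V))

instance [RigidCategory C] [IsMultiFusion k C] {I : Type*} [Fintype I] (V : I → C) (X : C) :
    FiniteDimensional k ((longFunctor k V).obj X) :=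
  IsMultiFusion.finiteDimensional_hom (⨁ V) ((⨁ V) ⊗ X)

/-- `H = coend(C, ω)` for the long canonical functor `ω`. -/
abbrev Reconstructed {I : Type*} [Fintype I] (V : I → C) : Type (max u v w) :=
  Coend (longFunctor k V)

/-- The defining property of the linear form `ζ_j` on `H`: for all simple `X`, it takes the value
`ε([θ|v]_X)` on `[θ|v]_X` if `X ≅ V_j`, and the value zero otherwise. -/
def IsComponentCounit [RigidCategory C] [IsMultiFusion k C] {I : Type*} [Fintype I] (V : I → C)
    (j : I) (ζ : Reconstructed k V →ₗ[k] k) : Prop :=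
  ∀ X : C, IsSplitSimple k X →
    ∀ (θ : Module.Dual k ((longFunctor k V).obj X)) (v : (longFunctor k V).obj X),
      (Nonempty (X ≅ V j) → ζ (Coend.bracket _ X θ v) =
        Coalgebra.counit (R := k) (Coend.bracket (longFunctor k V) X θ v)) ∧
      (¬ Nonempty (X ≅ V j) → ζ (Coend.bracket _ X θ v) = 0)

end LongFunctor

/-! ### Linear forms on coalgebras -/

section Forms

variable (k : Type w) [Field k] (H : Type*) [AddCommGroup H] [Module k H] [Coalgebra k H]

/-- The space of dual central linear forms: `f(x') x'' = x' f(x'')` for all `x`. -/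
def dualCentral : Submodule k (H →ₗ[k] k) where
  carrier := {f | ∀ x : H,
    TensorProduct.lid k H (f.rTensor H (Coalgebra.comul (R := k) x)) =
      TensorProduct.rid k H (f.lTensor H (Coalgebra.comul (R := k) x))}
  zero_mem' := by intro x; simp
  add_mem' := by
    intro f g hf hg x
    simp only [LinearMap.rTensor_add, LinearMap.lTensor_add, LinearMap.add_apply, map_add,
      hf x, hg x]
  smul_mem' := by
    intro c f hf x
    simp only [LinearMap.rTensor_smul, LinearMap.lTensor_smul, LinearMap.smul_apply, map_smul,
      hf x]

variable {k H}

/-- The convolution product `x ↦ f(x') g(x'')` of linear forms. -/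
def convolution (f g : H →ₗ[k] k) : H →ₗ[k] k :=
  LinearMap.mul' k k ∘ₗ TensorProduct.map f g ∘ₗ Coalgebra.comul

/-- `f` has a two-sided inverse with respect to convolution; the unit is the counit. -/
def IsConvolutionInvertible (f : H →ₗ[k] k) : Prop :=
  ∃ g : H →ₗ[k] k, convolution f g = Coalgebra.counit ∧ convolution g f = Coalgebra.counit

end Forms

end TannakaKrein

end

open TannakaKrein

namespace TannakaKrein

/-! ### Schur's lemma and decompositions of identities -/

section Semisimple

variable {k : Type w} [Field k] {C : Type u} [Category.{v} C] [Preadditive C] [Linear k C]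

/-! By semisimplicity, a linear form on the coend is the same as an arbitrary family of
endomorphisms `A j` of the spaces `F.obj (V j)`, via `[θ|v] ↦ θ (A j v)`: uniqueness is
`coend_hom_ext`, existence is `exists_form`. Convolution becomes composition, so the dual of `H` is
a product of matrix algebras and dual centrality is centrality there. Commuting with rank-one
endomorphisms forces each block to be a scalar (`exists_eq_smul_counit_of_mem_dualCentral`), and `ζ
j` is the identity of block `j`.

Independence of the `ζ j`, and the necessity of `c j ≠ 0`, also need every block to be non-zero.
This is the only place where the particular functor matters (`exists_dual_apply_eq_one`). -/

theorem IsSplitSimple.exists_eq_smul_id {X : C} (hX : IsSplitSimple k X) (f : X ⟶ X) :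
    ∃ c : k, f = c • 𝟙 X := by
  obtain ⟨e⟩ := hX
  refine ⟨e f, e.injective ?_⟩
  have h : e (e f • (1 : End X)) = e f := by rw [map_smul, map_one, smul_eq_mul, mul_one]
  exact h.symm

theorem IsSplitSimple.id_ne_zero {X : C} (hX : IsSplitSimple k X) : 𝟙 X ≠ 0 := by
  obtain ⟨e⟩ := hX
  intro h
  have h' : (1 : End X) = 0 := h
  exact one_ne_zero (α := k) (by rw [← map_one e, h', map_zero])

variable [HasFiniteBiproducts C] [MonoidalCategory C] [MonoidalPreadditive C]
  [MonoidalLinear k C] [RigidCategory C] [IsMultiFusion k C] {I : Type*} {V : I → C}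

/-- The identity of every object factors through finitely many of the representatives. -/
theorem IsSimpleRepresentatives.exists_decomposition (hV : IsSimpleRepresentatives k V) (X : C) :
    ∃ (n : ℕ) (j : Fin n → I) (p : ∀ i, X ⟶ V (j i)) (q : ∀ i, V (j i) ⟶ X),
      ∑ i, p i ≫ q i = 𝟙 X := by
  obtain ⟨n, S, hS, ⟨e⟩⟩ := IsMultiFusion.exists_iso_biproduct (k := k) X
  choose j hj using fun i => hV.exhaustive (S i) (hS i)
  have φ : ∀ i, S i ≅ V (j i) := fun i => (hj i).some
  refine ⟨n, j, fun i => e.hom ≫ biproduct.π S i ≫ (φ i).hom,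
    fun i => (φ i).inv ≫ biproduct.ι S i ≫ e.inv, ?_⟩
  have h := biproduct.total (f := S)
  calc _ = e.hom ≫ (∑ i, biproduct.π S i ≫ biproduct.ι S i) ≫ e.inv := by
        rw [Preadditive.sum_comp, Preadditive.comp_sum]; simp
    _ = 𝟙 X := by rw [h]; simp

end Semisimple

/-! ### Linear forms and convolution on brackets -/

section Coend

variable {k : Type w} [Field k] {C : Type u} [Category.{v} C]

namespace Coend

variable {F : C ⥤ ModuleCat.{v} k}

/-- The linear form `[θ|v]_X ↦ θ (A_X v)` induced by a natural family of endomorphisms `A_X`. -/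
noncomputable def formOfNatural (A : ∀ X, F.obj X →ₗ[k] F.obj X)
    (hA : ∀ {X Y : C} (f : X ⟶ Y) (v : F.obj X), A Y ((F.map f).hom v) = (F.map f).hom (A X v)) :
    Coend F →ₗ[k] k :=
  desc (fun X => contractLeft k (F.obj X) ∘ₗ (A X).lTensor _) fun f θ v => by
    simp only [LinearMap.comp_apply, LinearMap.lTensor_tmul, contractLeft_apply, hA]

theorem formOfNatural_bracket (A : ∀ X, F.obj X →ₗ[k] F.obj X)
    (hA : ∀ {X Y : C} (f : X ⟶ Y) (v : F.obj X), A Y ((F.map f).hom v) = (F.map f).hom (A X v))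
    (X : C) (θ : Module.Dual k (F.obj X)) (v : F.obj X) :
    formOfNatural A hA (bracket F X θ v) = θ (A X v) := by
  have h := desc_bracket (F := F) (fun X => contractLeft k (F.obj X) ∘ₗ (A X).lTensor _)
    (fun f θ v => by
      simp only [LinearMap.comp_apply, LinearMap.lTensor_tmul, contractLeft_apply, hA]) X θ v
  rwa [LinearMap.comp_apply, LinearMap.lTensor_tmul, contractLeft_apply] at h

variable [∀ X, FiniteDimensional k (F.obj X)]

theorem coalgebra_counit_bracket (X : C) (θ : Module.Dual k (F.obj X)) (v : F.obj X) :
    Coalgebra.counit (R := k) (bracket F X θ v) = θ v :=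
  counit_bracket X θ v

theorem coalgebra_comul_bracket (X : C) (θ : Module.Dual k (F.obj X)) (v : F.obj X) :
    Coalgebra.comul (R := k) (bracket F X θ v) =
      ∑ m, bracket F X θ (Module.finBasis k (F.obj X) m) ⊗ₜ[k]
        bracket F X ((Module.finBasis k (F.obj X)).coord m) v :=
  comul_bracket X θ v

theorem sum_apply_smul_bracket_left (X : C) (θ : Module.Dual k (F.obj X)) (v : F.obj X) :
    ∑ m, θ (Module.finBasis k (F.obj X) m) •
      bracket F X ((Module.finBasis k (F.obj X)).coord m) v = bracket F X θ v := by
  rw [← bracket_sum_left, ← dual_eq_sum]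

theorem sum_apply_smul_bracket_right (X : C) (θ : Module.Dual k (F.obj X)) (v : F.obj X) :
    ∑ m, (Module.finBasis k (F.obj X)).coord m v •
      bracket F X θ (Module.finBasis k (F.obj X) m) = bracket F X θ v := by
  rw [← bracket_sum_right]
  congr 1
  exact (Module.finBasis k (F.obj X)).sum_repr v

theorem lid_rTensor_comul_bracket (f : Coend F →ₗ[k] k) (X : C)
    (θ : Module.Dual k (F.obj X)) (v : F.obj X) :
    TensorProduct.lid k _ (f.rTensor _ (Coalgebra.comul (R := k) (bracket F X θ v))) =
      ∑ m, f (bracket F X θ (Module.finBasis k (F.obj X) m)) •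
        bracket F X ((Module.finBasis k (F.obj X)).coord m) v := by
  simp [coalgebra_comul_bracket]

theorem rid_lTensor_comul_bracket (f : Coend F →ₗ[k] k) (X : C)
    (θ : Module.Dual k (F.obj X)) (v : F.obj X) :
    TensorProduct.rid k _ (f.lTensor _ (Coalgebra.comul (R := k) (bracket F X θ v))) =
      ∑ m, f (bracket F X ((Module.finBasis k (F.obj X)).coord m) v) •
        bracket F X θ (Module.finBasis k (F.obj X) m) := by
  simp [coalgebra_comul_bracket]

theorem convolution_bracket (f g : Coend F →ₗ[k] k) (X : C)
    (θ : Module.Dual k (F.obj X)) (v : F.obj X) :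
    convolution f g (bracket F X θ v) =
      ∑ m, f (bracket F X θ (Module.finBasis k (F.obj X) m)) *
        g (bracket F X ((Module.finBasis k (F.obj X)).coord m) v) := by
  simp [convolution, coalgebra_comul_bracket]

/-- If `f` is `c` times the counit on the component of `X`, then so is convolution by `f`. -/
theorem convolution_bracket_of_eq_smul {f : Coend F →ₗ[k] k} (g : Coend F →ₗ[k] k) {X : C} {c : k}
    (hf : ∀ θ v, f (bracket F X θ v) = c * θ v) (θ : Module.Dual k (F.obj X)) (v : F.obj X) :
    convolution f g (bracket F X θ v) = c * g (bracket F X θ v) := by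
  rw [convolution_bracket]
  conv_rhs => rw [← sum_apply_smul_bracket_left X θ v]
  simp [hf, Finset.mul_sum, mul_assoc]

end Coend

end Coend

section CoendForms

variable {k : Type w} [Field k] {C : Type u} [Category.{v} C] {F : C ⥤ ModuleCat.{v} k}
  {I : Type*} [Fintype I] [DecidableEq I] {V : I → C} {ζ : I → Coend F →ₗ[k] k}

theorem sum_smul_bracket
    (hζ : ∀ j i θ v, ζ j (Coend.bracket F (V i) θ v) = (if i = j then 1 else 0) * θ v)
    (c : I → k) (i : I) (θ : Module.Dual k (F.obj (V i))) (v : F.obj (V i)) :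
    (∑ j, c j • ζ j) (Coend.bracket F (V i) θ v) = c i * θ v := by
  simp [hζ]

end CoendForms

/-! ### Blocks of the coend of an additive functor -/

section Components

variable {k : Type w} [Field k] {C : Type u} [Category.{v} C] [Preadditive C] [Linear k C]
  [HasFiniteBiproducts C] [MonoidalCategory C] [MonoidalPreadditive C]
  [MonoidalLinear k C] [RigidCategory C] [IsMultiFusion k C] {I : Type*} {V : I → C}
  {F : C ⥤ ModuleCat.{v} k} [F.Additive]

theorem IsSimpleRepresentatives.exists_map_decomposition (hV : IsSimpleRepresentatives k V)
    (F : C ⥤ ModuleCat.{v} k) [F.Additive] (X : C) :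
    ∃ (n : ℕ) (j : Fin n → I) (p : ∀ i, X ⟶ V (j i)) (q : ∀ i, V (j i) ⟶ X),
      ∀ v : F.obj X, ∑ i, (F.map (q i)).hom ((F.map (p i)).hom v) = v := by
  obtain ⟨n, j, p, q, h⟩ := hV.exists_decomposition X
  refine ⟨n, j, p, q, fun v => ?_⟩
  have h' := congrArg (fun f => (F.map f).hom v) h
  simpa [Functor.map_sum, ModuleCat.hom_sum] using h'

/-- Linear maps out of the coend are determined by the components of the simple objects. -/
theorem IsSimpleRepresentatives.coend_hom_ext (hV : IsSimpleRepresentatives k V)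
    {M : Type*} [AddCommGroup M] [Module k M] {a b : Coend F →ₗ[k] M}
    (h : ∀ j θ v, a (Coend.bracket F (V j) θ v) = b (Coend.bracket F (V j) θ v)) : a = b := by
  refine Coend.hom_ext fun X θ v => ?_
  -- The coend relation moves each `q i` onto `θ`, leaving brackets over representatives only.
  obtain ⟨n, j, p, q, hv⟩ := hV.exists_map_decomposition F X
  have key : Coend.bracket F X θ v = ∑ i, Coend.bracket F (V (j i))
      (θ ∘ₗ (F.map (q i)).hom) ((F.map (p i)).hom v) := by
    have h2 := Coend.bracket_sum_right (F := F) X (fun _ : Fin n => (1 : k)) θ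
      (fun i => (F.map (q i)).hom ((F.map (p i)).hom v))
    simp only [one_smul, hv] at h2
    rw [h2]
    exact Finset.sum_congr rfl fun i _ => Coend.bracket_map _ _ _
  rw [key, map_sum, map_sum]
  exact Finset.sum_congr rfl fun i _ => h _ _ _

/-- A linear form which is a multiple of the counit on the component of each simple object is
dual central. -/
theorem IsSimpleRepresentatives.mem_dualCentral [∀ X, FiniteDimensional k (F.obj X)]
    (hV : IsSimpleRepresentatives k V)
    {f : Coend F →ₗ[k] k} {c : I → k}
    (hf : ∀ j θ v, f (Coend.bracket F (V j) θ v) = c j * θ v) : f ∈ dualCentral k (Coend F) := by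
  have h : (TensorProduct.lid k (Coend F)).toLinearMap ∘ₗ f.rTensor (Coend F) ∘ₗ
      Coalgebra.comul (R := k) = (TensorProduct.rid k (Coend F)).toLinearMap ∘ₗ
      f.lTensor (Coend F) ∘ₗ Coalgebra.comul (R := k) := by
    refine hV.coend_hom_ext fun j θ v => ?_
    simp only [LinearMap.comp_apply, LinearEquiv.coe_coe]
    rw [Coend.lid_rTensor_comul_bracket, Coend.rid_lTensor_comul_bracket]
    simp only [hf, mul_smul, ← Finset.smul_sum, Coend.sum_apply_smul_bracket_left,
      Coend.sum_apply_smul_bracket_right]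
  exact fun x => LinearMap.congr_fun h x

/-- A combination of the counits of the components is convolution invertible iff all its
coefficients are non-zero. -/
theorem IsSimpleRepresentatives.isConvolutionInvertible_iff
    [∀ X, FiniteDimensional k (F.obj X)] [Fintype I] [DecidableEq I]
    {ζ : I → Coend F →ₗ[k] k} {η : ∀ j, Module.Dual k (F.obj (V j))} {u : ∀ j, F.obj (V j)}
    (hV : IsSimpleRepresentatives k V)
    (hζ : ∀ j i θ v, ζ j (Coend.bracket F (V i) θ v) = (if i = j then 1 else 0) * θ v)
    (hηu : ∀ j, η j (u j) = 1) (c : I → k) :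
    IsConvolutionInvertible (∑ j, c j • ζ j) ↔ ∀ j, c j ≠ 0 := by
  have hsum := sum_smul_bracket hζ
  constructor
  · rintro ⟨g, hg, -⟩ i hi
    -- At `[η i|u i]` the counit is `1`, while a vanishing `c i` makes the convolution `0`.
    have h1 := Coend.convolution_bracket_of_eq_smul g (hsum c i) (η i) (u i)
    rw [hg, Coend.coalgebra_counit_bracket, hηu, hi, zero_mul] at h1
    exact one_ne_zero h1
  · intro hc
    have hmul : ∀ a b : I → k, (∀ i, a i * b i = 1) →
        convolution (∑ j, a j • ζ j) (∑ j, b j • ζ j) = Coalgebra.counit := by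
      intro a b hab
      refine hV.coend_hom_ext fun i θ v => ?_
      rw [Coend.convolution_bracket_of_eq_smul _ (hsum a i), hsum, ← mul_assoc, hab, one_mul,
        Coend.coalgebra_counit_bracket]
    exact ⟨∑ j, (c j)⁻¹ • ζ j, hmul _ _ fun i => mul_inv_cancel₀ (hc i),
      hmul _ _ fun i => inv_mul_cancel₀ (hc i)⟩

variable [F.Linear k]

/-- A family of endomorphisms indexed by the simple objects commutes with all morphisms
between them. -/
theorem IsSimpleRepresentatives.map_comm (hV : IsSimpleRepresentatives k V)
    (A : ∀ j, F.obj (V j) →ₗ[k] F.obj (V j)) {i j : I} (f : V i ⟶ V j) (v : F.obj (V i)) :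
    A j ((F.map f).hom v) = (F.map f).hom (A i v) := by
  by_cases hij : i = j
  · subst hij
    obtain ⟨c, rfl⟩ := (hV.simple i).exists_eq_smul_id f
    simp [Functor.map_smul]
  · have hf : f = 0 := IsMultiFusion.hom_eq_zero (k := k) (hV.simple i) (hV.simple j)
      (fun h => hij (hV.injective i j h)) f
    simp [hf]

/-- Endomorphisms on the components of the simple objects extend to a linear form on the coend. -/
theorem IsSimpleRepresentatives.exists_form (hV : IsSimpleRepresentatives k V)
    (A : ∀ j, F.obj (V j) →ₗ[k] F.obj (V j)) :
    ∃ f : Coend F →ₗ[k] k, ∀ j θ v, f (Coend.bracket F (V j) θ v) = θ (A j v) := by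
  choose n j p q h using hV.exists_map_decomposition F
  -- Transport `A` to every object through a chosen decomposition; naturality has to be checked
  -- despite the choice.
  let B : ∀ X, F.obj X →ₗ[k] F.obj X := fun X =>
    ∑ i, (F.map (q X i)).hom ∘ₗ A (j X i) ∘ₗ (F.map (p X i)).hom
  have hB : ∀ X v, B X v =
      ∑ i, (F.map (q X i)).hom (A (j X i) ((F.map (p X i)).hom v)) := by
    intro X v
    simp [B]
  have comp : ∀ {X Y Z : C} (f : X ⟶ Y) (g : Y ⟶ Z) (v : F.obj X),
      (F.map g).hom ((F.map f).hom v) = (F.map (f ≫ g)).hom v := by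
    intro X Y Z f g v
    simp
  -- Each `f ≫ p X m` is a morphism between representatives, so `A` commutes with it. This gives
  -- naturality of `B` and, for `f = 𝟙`, its value on `V i`.
  have hpB : ∀ {X : C} {i : I} (f : V i ⟶ X) (v : F.obj (V i)),
      B X ((F.map f).hom v) = (F.map f).hom (A i v) := by
    intro X i f v
    rw [hB]
    conv_rhs => rw [← h X ((F.map f).hom (A i v))]
    refine Finset.sum_congr rfl fun m _ => ?_
    rw [comp f, comp f, hV.map_comm A]
  refine ⟨Coend.formOfNatural B ?_, fun i θ v => ?_⟩
  · intro X Y f v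
    conv_lhs => rw [← h X v]
    rw [map_sum, map_sum, hB X, map_sum]
    refine Finset.sum_congr rfl fun m _ => ?_
    rw [comp (q X m) f, hpB, comp (q X m) f]
  · rw [Coend.formOfNatural_bracket]
    have h' := hpB (𝟙 (V i)) v
    simp only [F.map_id, ModuleCat.hom_id, LinearMap.id_apply] at h'
    rw [h']

variable [∀ X, FiniteDimensional k (F.obj X)]

/-- A dual central linear form is a multiple of the counit on the component of a simple object. -/
theorem IsSimpleRepresentatives.exists_eq_smul_counit_of_mem_dualCentral
    (hV : IsSimpleRepresentatives k V) {f : Coend F →ₗ[k] k}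
    (hf : f ∈ dualCentral k (Coend F)) (j : I) :
    ∃ c : k, ∀ θ v, f (Coend.bracket F (V j) θ v) = c * θ v := by
  classical
  have key : ∀ (θ η : Module.Dual k (F.obj (V j))) (u v : F.obj (V j)),
      f (Coend.bracket F (V j) θ u) * η v = θ u * f (Coend.bracket F (V j) η v) := by
    intro θ η u v
    -- Test against the rank-one endomorphism `v ↦ η v • u` in block `j`, zero in the others; `key`
    -- is then the identity `f * g = g * f` at `[θ|v]`.
    obtain ⟨g, hg⟩ := hV.exists_form (F := F)
      (Function.update (fun _ => 0) j (LinearMap.toSpanSingleton k _ u ∘ₗ η))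
    replace hg : ∀ θ v, g (Coend.bracket F (V j) θ v) = η v * θ u := by
      intro θ v
      rw [hg]
      simp
    have h := congrArg g (hf (Coend.bracket F (V j) θ v))
    rw [Coend.lid_rTensor_comul_bracket, Coend.rid_lTensor_comul_bracket] at h
    simp only [map_sum, map_smul, smul_eq_mul, hg] at h
    have h1 := congrArg f (Coend.sum_apply_smul_bracket_right (F := F) (V j) θ u)
    have h2 := congrArg f (Coend.sum_apply_smul_bracket_left (F := F) (V j) η v)
    simp only [map_sum, map_smul, smul_eq_mul] at h1 h2
    rw [← h1, ← h2, Finset.sum_mul, Finset.mul_sum]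
    refine Eq.trans (Finset.sum_congr rfl fun m _ => by ring)
      (h.trans (Finset.sum_congr rfl fun m _ => by ring))
  by_cases hz : ∃ (η : Module.Dual k (F.obj (V j))) (v : F.obj (V j)), η v ≠ 0
  · obtain ⟨η, v, hηv⟩ := hz
    refine ⟨f (Coend.bracket F (V j) η v) / η v, fun θ u => ?_⟩
    have := key θ η u v
    field_simp
    linear_combination this
  -- If all pairings vanish, the dual space is zero and any scalar works.
  · push Not at hz
    refine ⟨0, fun θ u => ?_⟩
    have : θ = 0 := LinearMap.ext (hz θ)
    simp [this, Coend.bracket]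

/-- The counits of the components form a basis of the space of dual central linear forms. -/
theorem IsSimpleRepresentatives.exists_basis_dualCentral
    [Fintype I] [DecidableEq I] {ζ : I → Coend F →ₗ[k] k}
    {η : ∀ j, Module.Dual k (F.obj (V j))} {u : ∀ j, F.obj (V j)}
    (hV : IsSimpleRepresentatives k V)
    (hζ : ∀ j i θ v, ζ j (Coend.bracket F (V i) θ v) = (if i = j then 1 else 0) * θ v)
    (hηu : ∀ j, η j (u j) = 1) :
    ∃ b : Module.Basis I k (dualCentral k (Coend F)), ∀ j, (b j : Coend F →ₗ[k] k) = ζ j := by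
  have hsum := sum_smul_bracket hζ
  -- Since `η j (u j) = 1`, evaluation at `[η j|u j]` reads off the scalar of block `j`.
  let e : dualCentral k (Coend F) ≃ₗ[k] (I → k) :=
    { toFun := fun f j => f.1 (Coend.bracket F (V j) (η j) (u j))
      map_add' := fun f g => rfl
      map_smul' := fun c f => rfl
      invFun := fun c => ⟨∑ j, c j • ζ j, hV.mem_dualCentral (hsum c)⟩
      left_inv := by
        rintro ⟨f, hf⟩
        choose c hc using hV.exists_eq_smul_counit_of_mem_dualCentral hf
        refine Subtype.ext (hV.coend_hom_ext fun i θ v => ?_)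
        refine (hsum _ i θ v).trans ?_
        change f (Coend.bracket F (V i) (η i) (u i)) * θ v = f (Coend.bracket F (V i) θ v)
        rw [hc i θ v, hc i (η i) (u i), hηu, mul_one]
      right_inv := fun c => funext fun i => (hsum c i _ _).trans (by rw [hηu, mul_one]) }
  refine ⟨Module.Basis.ofEquivFun e, fun j => ?_⟩
  rw [Module.Basis.coe_ofEquivFun]
  change ∑ i, (Pi.single j 1 : I → k) i • ζ i = ζ j
  rw [Finset.sum_eq_single j (fun i _ hi => by rw [Pi.single_eq_of_ne hi, zero_smul])
    (fun h => absurd (Finset.mem_univ j) h), Pi.single_eq_same, one_smul]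

end Components

/-! ### The long canonical functor -/

section LongFunctor

variable {k : Type w} [Field k] {C : Type u} [Category.{v} C] [Preadditive C] [Linear k C]
  [HasFiniteBiproducts C] [MonoidalCategory C] [MonoidalPreadditive C] [MonoidalLinear k C]
  {I : Type*} [Fintype I] {V : I → C}

instance : (longFunctor k V).Additive where
  map_add := by
    intro X Y f g
    refine ModuleCat.hom_ext (LinearMap.ext fun x => ?_)
    change x ≫ (⨁ V) ◁ (f + g) = x ≫ (⨁ V) ◁ f + x ≫ (⨁ V) ◁ g
    rw [MonoidalPreadditive.whiskerLeft_add]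
    exact Preadditive.comp_add _ _ _ x _ _

instance : (longFunctor k V).Linear k where
  map_smul := by
    intro X Y f r
    refine ModuleCat.hom_ext (LinearMap.ext fun x => ?_)
    change x ≫ (⨁ V) ◁ (r • f) = r • (x ≫ (⨁ V) ◁ f)
    rw [MonoidalLinear.whiskerLeft_smul]
    exact Linear.comp_smul _ _ _ x _ _

variable [RigidCategory C] [IsMultiFusion k C]

/-- The long canonical functor does not vanish on simple objects. -/
theorem IsSimpleRepresentatives.exists_dual_apply_eq_one (hV : IsSimpleRepresentatives k V)
    {X : C} (hX : IsSplitSimple k X) :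
    ∃ (θ : Module.Dual k ((longFunctor k V).obj X)) (v : (longFunctor k V).obj X), θ v = 1 := by
  by_contra hcon
  -- A non-zero vector would be detected by some functional.
  have hzero : ∀ g : (⨁ V) ⟶ (⨁ V) ⊗ X, g = 0 := by
    intro g
    by_contra hg
    obtain ⟨θ, hθ⟩ := Module.Projective.exists_dual_eq_one k hg
    exact hcon ⟨θ, g, hθ⟩
  have h1 : 𝟙 ((⨁ V) ⊗ X) = 0 := by
    obtain ⟨n, j, p, q, h⟩ := hV.exists_decomposition ((⨁ V) ⊗ X)
    rw [← h]
    refine Finset.sum_eq_zero fun i _ => ?_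
    -- Every representative is a summand of `⨁ V`, so a map out of it extends to `⨁ V` and hence
    -- vanishes.
    rw [← biproduct.ι_π_self_assoc V (j i) (q i), hzero (biproduct.π V (j i) ≫ q i)]
    simp
  -- `V j ⊗ X` is a retract of the zero object `(⨁ V) ⊗ X`.
  have h2 : ∀ j, 𝟙 (V j ⊗ X) = 0 := by
    intro j
    have : 𝟙 (V j ⊗ X) = (biproduct.ι V j ▷ X) ≫ 𝟙 ((⨁ V) ⊗ X) ≫ (biproduct.π V j ▷ X) := by
      rw [Category.id_comp, ← comp_whiskerRight, biproduct.ι_π_self, id_whiskerRight]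
    rw [this, h1]
    simp
  -- The unit need not be simple, so it is decomposed as well; then `X ≅ 𝟙_ C ⊗ X` is zero.
  have h3 : 𝟙 (𝟙_ C ⊗ X) = 0 := by
    obtain ⟨n, j, p, q, h⟩ := hV.exists_decomposition (𝟙_ C)
    rw [← id_whiskerRight, ← h, sum_whiskerRight]
    refine Finset.sum_eq_zero fun i _ => ?_
    rw [comp_whiskerRight, ← Category.id_comp (q i ▷ X), h2]
    simp
  refine hX.id_ne_zero ?_
  rw [← (λ_ X).inv_hom_id, ← Category.id_comp (λ_ X).hom, h3]
  simp

open Classical in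
/-- It suffices to test the defining property of `ζ_j` on the representatives. -/
theorem IsSimpleRepresentatives.isComponentCounit_iff (hV : IsSimpleRepresentatives k V) (j : I)
    (ζ : Reconstructed k V →ₗ[k] k) :
    IsComponentCounit k V j ζ ↔
      ∀ i θ v, ζ (Coend.bracket _ (V i) θ v) = (if i = j then 1 else 0) * θ v := by
  constructor
  · intro h i θ v
    split_ifs with hij
    · rw [(h (V i) (hV.simple i) θ v).1 ⟨eqToIso (by rw [hij])⟩, one_mul]
      exact Coend.coalgebra_counit_bracket _ _ _
    · rw [(h (V i) (hV.simple i) θ v).2 fun hiso => hij (hV.injective i j hiso), zero_mul]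
  · intro h X hX θ v
    obtain ⟨i, ⟨e⟩⟩ := hV.exhaustive X hX
    have hv : ((longFunctor k V).map e.inv).hom (((longFunctor k V).map e.hom).hom v) = v := by
      have := congrArg (fun f => ((longFunctor k V).map f).hom v) e.hom_inv_id
      rwa [Functor.map_comp, CategoryTheory.Functor.map_id] at this
    have hb : Coend.bracket (longFunctor k V) X θ v = Coend.bracket _ (V i)
        (θ ∘ₗ ((longFunctor k V).map e.inv).hom) (((longFunctor k V).map e.hom).hom v) := by
      rw [← Coend.bracket_map, hv]
    have hval : ζ (Coend.bracket _ X θ v) = (if i = j then 1 else 0) * θ v := by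
      rw [hb, h, LinearMap.comp_apply, hv]
    refine ⟨fun hiso => ?_, fun hiso => ?_⟩
    · rw [hval, if_pos (hV.injective i j ⟨e.symm ≪≫ hiso.some⟩), one_mul]
      exact (Coend.coalgebra_counit_bracket _ _ _).symm
    · rw [hval, if_neg, zero_mul]
      rintro rfl
      exact hiso ⟨e⟩

end LongFunctor

end TannakaKrein

open TannakaKrein
theorem mainTheorem11 {k : Type w} [Field k] {C : Type u} [Category.{v} C] [Preadditive C]
    [Linear k C] [HasFiniteBiproducts C] [MonoidalCategory C] [MonoidalPreadditive C]
    [MonoidalLinear k C] [RigidCategory C] [IsMultiFusion k C]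
    {I : Type*} [Fintype I] (V : I → C) (hV : IsSimpleRepresentatives k V) :
    (∀ j : I, ∃! ζ : Reconstructed k V →ₗ[k] k, IsComponentCounit k V j ζ) ∧
    ∀ ζ : I → Reconstructed k V →ₗ[k] k, (∀ j, IsComponentCounit k V j (ζ j)) →
      (∃ b : Module.Basis I k (dualCentral k (Reconstructed k V)),
        ∀ j, (b j : Reconstructed k V →ₗ[k] k) = ζ j) ∧
      ∀ c : I → k, IsConvolutionInvertible (∑ j, c j • ζ j) ↔ ∀ j, c j ≠ 0 := by
  classical
  refine ⟨fun j => ?_, fun ζ hζ => ?_⟩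
  -- `ζ j` comes from the central idempotent that is the identity on block `j` and zero elsewhere.
  · obtain ⟨f, hf⟩ := hV.exists_form (F := longFunctor k V)
      (fun i => (if i = j then (1 : k) else 0) • LinearMap.id)
    simp only [LinearMap.smul_apply, LinearMap.id_apply, map_smul, smul_eq_mul] at hf
    refine ⟨f, (hV.isComponentCounit_iff j f).2 hf, fun g hg => ?_⟩
    refine hV.coend_hom_ext fun i θ v => ?_
    rw [(hV.isComponentCounit_iff j g).1 hg, hf]
  have hζ' := fun j => (hV.isComponentCounit_iff j (ζ j)).1 (hζ j)
  choose η u hηu using fun j => hV.exists_dual_apply_eq_one (hV.simple j)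
  exact ⟨hV.exists_basis_dualCentral hζ' hηu, hV.isConvolutionInvertible_iff hζ' hηu⟩
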